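/- A binary tree is either a leaf or a node with a left and a right subtree, each of which is a binary tree; the height of a leaf is $0$ and the height of a tree with subtrees $L,R$ is $1+\max\{\operatorname{h}(L),\operatorname{h}(R)\}$. A tree is balanced if $\operatorname{h}(R)-\operatorname{h}(L)\in\{-1,0,1\}$ at each of its nodes, where $L$ and $R$ are the left and right subtrees of the node. A right rotation replaces a subtree $(A\wedge B)\wedge C$ by $A\wedge(B\wedge C)$, and the Tamari order $\le_{\mathrm T}$ is the reflexive and transitive closure of right rotation. A balanced tree $T$ is minimal if every tree from which $T$ is obtained by one right rotation is unbalanced, and maximal if every tree obtained from $T$ by one right rotation is unbalanced. A maximal balanced binary tree interval is an interval $[T_0,T_1]$, $T_0\le_{\mathrm T}T_1$, of the Tamari order with $T_0$ a minimal and $T_1$ a maximal balanced tree. **Proposition.** (1) There is a unique formal power series $\mathcal S_{\mathrm{mbi}}(x,y,z,t)\in\mathbb Z[[x,y,z,t]]$ with constant term $0$ such that $$\mathcal S_{\mathrm{mbi}}(x,y,z,t)=x+\mathcal S_{\mathrm{mbi}}(x^2+2yt+yz,\;x,\;x^2+xy,\;yt+yz),$$ and $\mathcal S_{\mathrm{mbi}}(x,0,0,0)$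 is the generating series of maximal balanced binary tree intervals by number of leaves: for every $n\ge 0$ the coefficient of $x^n$ is the number of maximal balanced binary tree intervals whose trees have $n$ leaves. (2) Each maximal balanced binary tree interval, with the order $\le_{\mathrm T}$, is isomorphic as a poset to the hypercube of dimension $k$ (the subsets of a $k$-element set ordered by inclusion) for exactly one $k\ge 0$. There is a unique formal power series $\mathcal S_{\mathrm{mbi}}(x,y,z,t,\xi)$ in $x,y,z,t$ with coefficients in $\mathbb Z[\xi]$ and with constant term $0$ such that $$\mathcal S_{\mathrm{mbi}}(x,y,z,t,\xi)=x+\mathcal S_{\mathrm{mbi}}(x^2+2yt+yz\xi,\;x,\;x^2+xy,\;yt+yz\xi,\;\xi),$$ and for all $n,k\ge 0$ the coefficient of $x^n\xi^k$ in $\mathcal S_{\mathrm{mbi}}(x,0,0,0,\xi)$ is the number of maximal balanced binary tree intervals whose trees have $n$ leaves and which are isomorphic to the hypercube of dimension $k$. -/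

import Mathlib

/-! Binary trees are Mathlib's `BinaryTree Unit`: `nil` is the leaf and `node () L R` is the tree
with left subtree `L` and right subtree `R`; `height` and `numLeaves` are the usual statistics. -/

/-- A binary tree is balanced if each of its nodes, with left subtree `L` and right subtree `R`,
has imbalance `h(R) - h(L)` in `{-1, 0, 1}`. -/
def IsBalancedTree : BinaryTree Unit → Prop
  | .nil => True
  | .node _ L R =>
      ((R.height : ℤ) - (L.height : ℤ)) ∈ ({-1, 0, 1} : Set ℤ) ∧
        IsBalancedTree L ∧ IsBalancedTree R

/-- `TreeRotation T T'`: the tree `T'` is obtained from `T` by one right rotation, that is, by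
replacing a subtree `(A ∧ B) ∧ C` by `A ∧ (B ∧ C)`. -/
inductive TreeRotation : BinaryTree Unit → BinaryTree Unit → Prop
  | root (A B C : BinaryTree Unit) :
      TreeRotation (.node () (.node () A B) C) (.node () A (.node () B C))
  | left {L L' : BinaryTree Unit} (R : BinaryTree Unit) (h : TreeRotation L L') :
      TreeRotation (.node () L R) (.node () L' R)
  | right (L : BinaryTree Unit) {R R' : BinaryTree Unit} (h : TreeRotation R R') :
      TreeRotation (.node () L R) (.node () L R')

/-- The Tamari order: the reflexive and transitive closure of right rotation. -/
def TamariLE : BinaryTree Unit → BinaryTree Unit → Prop :=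
  Relation.ReflTransGen TreeRotation

/-- A balanced tree is minimal if every tree that rotates to it is unbalanced. -/
def IsMinimalBalanced (T : BinaryTree Unit) : Prop :=
  IsBalancedTree T ∧ ∀ T' : BinaryTree Unit, TreeRotation T' T → ¬ IsBalancedTree T'

/-- A balanced tree is maximal if every tree that it rotates to is unbalanced. -/
def IsMaximalBalanced (T : BinaryTree Unit) : Prop :=
  IsBalancedTree T ∧ ∀ T' : BinaryTree Unit, TreeRotation T T' → ¬ IsBalancedTree T'

/-- `(T₀, T₁)` are the end points of a maximal balanced binary tree interval `[T₀, T₁]`. -/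
def IsMaximalBalancedInterval (I : BinaryTree Unit × BinaryTree Unit) : Prop :=
  TamariLE I.1 I.2 ∧ IsMinimalBalanced I.1 ∧ IsMaximalBalanced I.2

/-- The elements of the Tamari interval `[T₀, T₁]`. -/
def TamariInterval (I : BinaryTree Unit × BinaryTree Unit) : Type :=
  {T : BinaryTree Unit // TamariLE I.1 T ∧ TamariLE T I.2}

/-- The interval `[T₀, T₁]`, with the Tamari order, is isomorphic as a poset to the hypercube of
dimension `k`: the subsets of a `k`-element set ordered by inclusion. -/
def IsHypercubeInterval (I : BinaryTree Unit × BinaryTree Unit) (k : ℕ) : Prop :=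
  Nonempty ((fun S T : TamariInterval I => TamariLE S.1 T.1) ≃r
    (fun a b : Finset (Fin k) => a ⊆ b))

/-- The maximal balanced binary tree intervals whose trees have `n` leaves. -/
def maximalBalancedIntervals (n : ℕ) : Set (BinaryTree Unit × BinaryTree Unit) :=
  {I | IsMaximalBalancedInterval I ∧ I.1.numLeaves = n ∧ I.2.numLeaves = n}

/-- There are finitely many of them, so that `Set.ncard` counts them. -/
theorem finite_maximalBalancedIntervals (n : ℕ) : (maximalBalancedIntervals n).Finite := by
  have hfin : {T : BinaryTree Unit | T.numLeaves = n}.Finite := by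
    refine (BinaryTree.treesOfNumNodesEq (n - 1)).finite_toSet.subset ?_
    intro T hT
    have h1 : T.numLeaves = n := hT
    rw [BinaryTree.numLeaves_eq_numNodes_succ] at h1
    simp only [Finset.mem_coe, BinaryTree.mem_treesOfNumNodesEq]
    omega
  exact (hfin.prod hfin).subset fun I hI => ⟨hI.2.1, hI.2.2⟩

/-- The generating series of the maximal balanced binary tree intervals by number of leaves. -/
noncomputable def maximalBalancedIntervalSeries : PowerSeries ℤ :=
  PowerSeries.mk fun n => ((maximalBalancedIntervals n).ncard : ℤ)

/-- The variables `x`, `y`, `z`, `t` are `X 0`, `X 1`, `X 2`, `X 3`. This is the substitution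
`x ↦ x² + 2yt + yzξ`, `y ↦ x`, `z ↦ x² + xy`, `t ↦ yt + yzξ`, where `ξ` is a scalar. -/
noncomputable def mbiSubs {R : Type} [CommRing R] (ξ : R) : Fin 4 → MvPowerSeries (Fin 4) R :=
  let x : MvPowerSeries (Fin 4) R := MvPowerSeries.X 0
  let y : MvPowerSeries (Fin 4) R := MvPowerSeries.X 1
  let z : MvPowerSeries (Fin 4) R := MvPowerSeries.X 2
  let t : MvPowerSeries (Fin 4) R := MvPowerSeries.X 3
  ![x ^ 2 + 2 * y * t + y * z * MvPowerSeries.C ξ,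
    x,
    x ^ 2 + x * y,
    y * t + y * z * MvPowerSeries.C ξ]

/-- The substitution is a legitimate one: all its series have constant term `0`. -/
theorem hasSubst_mbiSubs {R : Type} [CommRing R] (ξ : R) :
    MvPowerSeries.HasSubst (mbiSubs ξ) := by
  refine MvPowerSeries.hasSubst_of_constantCoeff_zero fun i => ?_
  fin_cases i <;> simp [mbiSubs]

/-- `S` has constant term `0` and satisfies
`S(x, y, z, t) = x + S(x² + 2yt + yzξ, x, x² + xy, yt + yzξ)`. -/
def IsMbiSolution {R : Type} [CommRing R] (ξ : R) (S : MvPowerSeries (Fin 4) R) : Prop :=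
  MvPowerSeries.constantCoeff S = 0 ∧
    S = MvPowerSeries.X 0 + MvPowerSeries.subst (mbiSubs ξ) S

/-- The specialization point `(x, 0, 0, 0)`, with values in series in the single variable `x`. -/
noncomputable def mbiPoint (R : Type) [CommRing R] : Fin 4 → MvPowerSeries Unit R :=
  ![(PowerSeries.X : PowerSeries R), 0, 0, 0]

/-- The specialization is legitimate. -/
theorem hasSubst_mbiPoint (R : Type) [CommRing R] : MvPowerSeries.HasSubst (mbiPoint R) := by
  refine MvPowerSeries.hasSubst_of_constantCoeff_zero fun i => ?_
  fin_cases i <;> simp [mbiPoint, PowerSeries.X]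

/-- The series `S(x, 0, 0, 0)`. -/
noncomputable def mbiSpecialize {R : Type} [CommRing R] (S : MvPowerSeries (Fin 4) R) :
    PowerSeries R :=
  MvPowerSeries.subst (mbiPoint R) S

/-! Cutting a tree along its left spine inverts the Tamari order one node at a time: the trees
below `L ∧ R` are those with a cut into a tree below `L` and a tree below `R`. If both ends of an
interval are balanced, the imbalance bound allows only cuts at the root or just below it, so the
interval is given by a pattern of rotations at disjoint nodes, which can be performed
independently: it is a hypercube whose dimension is the number of rotations. These rotations keep
all heights, so minimality and maximality are conditions on the heights at the nodes of the
pattern. They yield a recursion for the generating series of the maximal intervals of each height,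
and this recursion is the orbit of the point `(x, 0, 0, 0)` under the substitution of the
functional equation. The substitution raises a weighted order, so the unique solution is the sum
of the iterated substitutions applied to `x`, and `S(x, 0, 0, 0)` is the sum over all heights. -/

namespace BalancedTamari

section Tamari

variable {A A' B B' C C' L L' R R' Q S T T' : BinaryTree Unit}

theorem numLeaves_eq_of_treeRotation (h : TreeRotation T T') : T'.numLeaves = T.numLeaves := by
  induction h with
  | root A B C => simp only [BinaryTree.numLeaves]; omega
  | left R _ ih => simp only [BinaryTree.numLeaves, ih]
  | right L _ ih => simp only [BinaryTree.numLeaves, ih]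

theorem numLeaves_eq_of_tamariLE (h : TamariLE T T') : T'.numLeaves = T.numLeaves := by
  induction h with
  | refl => rfl
  | tail _ hr ih => rw [numLeaves_eq_of_treeRotation hr, ih]

theorem tamariLE_node (hL : TamariLE L L') (hR : TamariLE R R') :
    TamariLE (.node () L R) (.node () L' R') := by
  have hleft : TamariLE (.node () L R) (.node () L' R) :=
    Relation.ReflTransGen.lift (BinaryTree.node () · R) (fun _ _ => .left R) _ _ hL
  have hright : TamariLE (.node () L' R) (.node () L' R') :=
    Relation.ReflTransGen.lift (BinaryTree.node () L' ·) (fun _ _ => .right L') _ _ hR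
  exact hleft.trans hright

/-- `SpineCut Q A S`: the tree `Q` is cut at a node of its left spine, reached from the root by
going to left subtrees only. The lower part `A` is the left subtree of that node and `S` is what
remains of `Q` when `A` is contracted, so that the leaves of `A` precede those of `S`. -/
inductive SpineCut : BinaryTree Unit → BinaryTree Unit → BinaryTree Unit → Prop
  | root (A B : BinaryTree Unit) : SpineCut (.node () A B) A B
  | left {L A S : BinaryTree Unit} (C : BinaryTree Unit) (h : SpineCut L A S) :
      SpineCut (.node () L C) A (.node () S C)

theorem SpineCut.exists_of_treeRotation (hr : TreeRotation Q T) (h : SpineCut T A S) :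
    ∃ A' S', SpineCut Q A' S' ∧ TamariLE A' A ∧ TamariLE S' S := by
  induction h generalizing Q with
  | root A B =>
    cases hr with
    | root A B C => exact ⟨_, _, .left C (.root A B), .refl, .refl⟩
    | left _ hr => exact ⟨_, _, .root _ _, .single hr, .refl⟩
    | right _ hr => exact ⟨_, _, .root _ _, .refl, .single hr⟩
  | left C h ih =>
    cases hr with
    | root A B C => exact ⟨_, _, .left C (.left B h), .refl, .single (.root _ _ _)⟩
    | left _ hr =>
      obtain ⟨A', S', hcut, hA, hS⟩ := ih hr
      exact ⟨A', _, .left C hcut, hA, tamariLE_node hS .refl⟩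
    | right _ hr => exact ⟨_, _, .left _ h, .refl, tamariLE_node .refl (.single hr)⟩

theorem exists_spineCut_of_tamariLE_node (h : TamariLE Q (.node () L R)) :
    ∃ A S, SpineCut Q A S ∧ TamariLE A L ∧ TamariLE S R := by
  induction h using Relation.ReflTransGen.head_induction_on with
  | refl => exact ⟨L, R, .root L R, .refl, .refl⟩
  | head hr _ ih =>
    obtain ⟨A, S, hcut, hA, hS⟩ := ih
    obtain ⟨A', S', hcut', hA', hS'⟩ := hcut.exists_of_treeRotation hr
    exact ⟨A', S', hcut', hA'.trans hA, hS'.trans hS⟩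

theorem SpineCut.numLeaves_lt (h : SpineCut Q A S) : A.numLeaves < Q.numLeaves := by
  induction h with
  | root A B => have := B.numLeaves_pos; simp only [BinaryTree.numLeaves]; omega
  | left C _ ih => simp only [BinaryTree.numLeaves]; omega

theorem numLeaves_le_of_tamariLE_node (h : TamariLE (.node () L R) (.node () L' R')) :
    L'.numLeaves ≤ L.numLeaves := by
  obtain ⟨A, S, hcut, hA, -⟩ := exists_spineCut_of_tamariLE_node h
  rw [numLeaves_eq_of_tamariLE hA]
  cases hcut with
  | root => exact le_rfl
  | left _ hcut => exact hcut.numLeaves_lt.le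

theorem tamariLE_node_iff (hn : L'.numLeaves = L.numLeaves) :
    TamariLE (.node () L R) (.node () L' R') ↔ TamariLE L L' ∧ TamariLE R R' := by
  refine ⟨fun h => ?_, fun h => tamariLE_node h.1 h.2⟩
  obtain ⟨A, S, hcut, hA, hS⟩ := exists_spineCut_of_tamariLE_node h
  cases hcut with
  | root => exact ⟨hA, hS⟩
  | left _ hcut =>
    have := hcut.numLeaves_lt
    have := numLeaves_eq_of_tamariLE hA
    omega

theorem tamariLE_rotated_iff (hn : L.numLeaves = A.numLeaves) :
    TamariLE (.node () (.node () A B) C) (.node () L R) ↔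
      TamariLE A L ∧ TamariLE (.node () B C) R := by
  refine ⟨fun h => ?_, fun h => .head (.root A B C) (tamariLE_node h.1 h.2)⟩
  obtain ⟨D, S, hcut, hD, hS⟩ := exists_spineCut_of_tamariLE_node h
  have hDL := numLeaves_eq_of_tamariLE hD
  cases hcut with
  | root =>
    have := B.numLeaves_pos
    simp only [BinaryTree.numLeaves] at hDL
    omega
  | left _ hcut =>
    cases hcut with
    | root => exact ⟨hD, hS⟩
    | left _ hcut =>
      have := hcut.numLeaves_lt
      omega

theorem numLeaves_eq_or_le_of_tamariLE
    (h : TamariLE (.node () (.node () A B) C) (.node () L R)) :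
    L.numLeaves = A.numLeaves + B.numLeaves ∨ L.numLeaves ≤ A.numLeaves := by
  obtain ⟨D, S, hcut, hD, -⟩ := exists_spineCut_of_tamariLE_node h
  rw [numLeaves_eq_of_tamariLE hD]
  cases hcut with
  | root => exact .inl rfl
  | left _ hcut =>
    cases hcut with
    | root => exact .inr le_rfl
    | left _ hcut => exact .inr hcut.numLeaves_lt.le

theorem exists_eq_node_of_tamariLE (hl : TamariLE (.node () L R) T)
    (hu : TamariLE T (.node () L' R')) (hn : L'.numLeaves = L.numLeaves) :
    ∃ A B, T = .node () A B ∧ (TamariLE L A ∧ TamariLE A L') ∧ TamariLE R B ∧ TamariLE B R' := by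
  cases T with
  | nil =>
    have := numLeaves_eq_of_tamariLE hl
    have := L.numLeaves_pos
    have := R.numLeaves_pos
    simp only [BinaryTree.numLeaves] at *
    omega
  | node _ A B =>
    have hAL : A.numLeaves = L.numLeaves :=
      (numLeaves_le_of_tamariLE_node hl).antisymm (hn ▸ numLeaves_le_of_tamariLE_node hu)
    obtain ⟨hLA, hRB⟩ := (tamariLE_node_iff hAL).1 hl
    obtain ⟨hAL', hBR'⟩ := (tamariLE_node_iff (hn.trans hAL.symm)).1 hu
    exact ⟨A, B, rfl, ⟨hLA, hAL'⟩, hRB, hBR'⟩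

theorem exists_eq_or_eq_rotated_of_tamariLE (hl : TamariLE (.node () (.node () A B) C) T)
    (hu : TamariLE T (.node () A' (.node () B' C'))) (hA : A'.numLeaves = A.numLeaves)
    (hB : B'.numLeaves = B.numLeaves) :
    ∃ D E F, (T = .node () (.node () D E) F ∨ T = .node () D (.node () E F)) ∧
      (TamariLE A D ∧ TamariLE D A') ∧ (TamariLE B E ∧ TamariLE E B') ∧
        TamariLE C F ∧ TamariLE F C' := by
  have hApos := A.numLeaves_pos
  have hBpos := B.numLeaves_pos
  have hT := numLeaves_eq_of_tamariLE hl
  rcases T with _ | ⟨_, L, F⟩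
  · simp only [BinaryTree.numLeaves] at hT
    omega
  rcases numLeaves_eq_or_le_of_tamariLE hl with hL | hLA
  · rw [tamariLE_node_iff (by rw [hL, BinaryTree.numLeaves])] at hl
    rcases L with _ | ⟨_, D, E⟩
    · rw [BinaryTree.numLeaves] at hL
      omega
    have hDA : D.numLeaves = A.numLeaves := by
      have := numLeaves_le_of_tamariLE_node hl.1
      have := numLeaves_eq_or_le_of_tamariLE hu
      rw [BinaryTree.numLeaves] at hL
      omega
    have hEB : E.numLeaves = B.numLeaves := by
      rw [BinaryTree.numLeaves] at hL
      omega
    rw [tamariLE_node_iff hDA] at hl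
    rw [tamariLE_rotated_iff (hA.trans hDA.symm), tamariLE_node_iff (hB.trans hEB.symm)] at hu
    exact ⟨D, E, F, .inl rfl, ⟨hl.1.1, hu.1⟩, ⟨hl.1.2, hu.2.1⟩, hl.2, hu.2.2⟩
  · have hLA : L.numLeaves = A.numLeaves :=
      hLA.antisymm (hA ▸ numLeaves_le_of_tamariLE_node hu)
    rw [tamariLE_rotated_iff hLA] at hl
    rw [tamariLE_node_iff (hA.trans hLA.symm)] at hu
    obtain ⟨E, F, rfl, hE, hF⟩ := exists_eq_node_of_tamariLE hl.2 hu.2 hB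
    exact ⟨L, E, F, .inr rfl, ⟨hl.1, hu.1⟩, hE, hF⟩

end Tamari

/-- A pattern of rotations at pairwise disjoint nodes. It encodes the interval from the tree
`lower`, in which none of the rotations of the pattern is done, to the tree `upper`, in which all
of them are: `node P Q` does no rotation at the root and `rot P Q S` is the rotation from
`(P ∧ Q) ∧ S` to `P ∧ (Q ∧ S)`. -/
inductive RotationPattern : Type
  | leaf
  | node (P Q : RotationPattern)
  | rot (P Q S : RotationPattern)

namespace RotationPattern

/-- The tree of the pattern with no rotation done. -/
def lower : RotationPattern → BinaryTree Unit
  | leaf => .nil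
  | node P Q => .node () P.lower Q.lower
  | rot P Q S => .node () (.node () P.lower Q.lower) S.lower

/-- The tree of the pattern with all rotations done. -/
def upper : RotationPattern → BinaryTree Unit
  | leaf => .nil
  | node P Q => .node () P.upper Q.upper
  | rot P Q S => .node () P.upper (.node () Q.upper S.upper)

/-- The number of leaves of the trees of the pattern. -/
def numLeaves : RotationPattern → ℕ
  | leaf => 1
  | node P Q => P.numLeaves + Q.numLeaves
  | rot P Q S => P.numLeaves + Q.numLeaves + S.numLeaves

/-- The number of rotations of the pattern. -/
def dim : RotationPattern → ℕ
  | leaf => 0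
  | node P Q => P.dim + Q.dim
  | rot P Q S => P.dim + Q.dim + S.dim + 1

/-- The rotations of the pattern; the rotation at the root of `rot P Q S` is `none`. -/
@[reducible] def Sites : RotationPattern → Type
  | leaf => Empty
  | node P Q => P.Sites ⊕ Q.Sites
  | rot P Q S => Option ((P.Sites ⊕ Q.Sites) ⊕ S.Sites)

instance instFintypeSites : ∀ P : RotationPattern, Fintype P.Sites
  | leaf => inferInstanceAs (Fintype Empty)
  | node P Q =>
    haveI := instFintypeSites P
    haveI := instFintypeSites Q
    inferInstanceAs (Fintype (P.Sites ⊕ Q.Sites))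
  | rot P Q S =>
    haveI := instFintypeSites P
    haveI := instFintypeSites Q
    haveI := instFintypeSites S
    inferInstanceAs (Fintype (Option ((P.Sites ⊕ Q.Sites) ⊕ S.Sites)))

theorem card_sites : ∀ P : RotationPattern, Fintype.card P.Sites = P.dim
  | leaf => Fintype.card_empty
  | node P Q => by
    rw [dim, ← card_sites P, ← card_sites Q]
    exact Fintype.card_sum
  | rot P Q S => by
    rw [dim, ← card_sites P, ← card_sites Q, ← card_sites S]
    exact Fintype.card_option.trans (by rw [Fintype.card_sum, Fintype.card_sum])

open Classical in
/-- The tree obtained by doing the rotations in `a`. -/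
noncomputable def vertex : (P : RotationPattern) → Set P.Sites → BinaryTree Unit
  | leaf, _ => .nil
  | node P Q, a => .node () (P.vertex (Sum.inl ⁻¹' a)) (Q.vertex (Sum.inr ⁻¹' a))
  | rot P Q S, a =>
    let A := P.vertex ((some ∘ .inl ∘ .inl) ⁻¹' a)
    let B := Q.vertex ((some ∘ .inl ∘ .inr) ⁻¹' a)
    let C := S.vertex ((some ∘ .inr) ⁻¹' a)
    if none ∈ a then .node () A (.node () B C) else .node () (.node () A B) C

theorem vertex_empty (P : RotationPattern) : P.vertex ∅ = P.lower := by
  induction P with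
  | leaf => rfl
  | node P Q hP hQ => simp only [vertex, lower, Set.preimage_empty, hP, hQ]
  | rot P Q S hP hQ hS =>
    simp only [vertex, lower, Set.preimage_empty, hP, hQ, hS, Set.mem_empty_iff_false, if_false]

theorem vertex_univ (P : RotationPattern) : P.vertex Set.univ = P.upper := by
  induction P with
  | leaf => rfl
  | node P Q hP hQ => simp only [vertex, upper, Set.preimage_univ, hP, hQ]
  | rot P Q S hP hQ hS =>
    simp only [vertex, upper, Set.preimage_univ, hP, hQ, hS, Set.mem_univ, if_true]

theorem numLeaves_vertex (P : RotationPattern) (a : Set P.Sites) :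
    (P.vertex a).numLeaves = P.numLeaves := by
  induction P with
  | leaf => rfl
  | node P Q hP hQ => simp only [vertex, numLeaves, BinaryTree.numLeaves, hP, hQ]
  | rot P Q S hP hQ hS =>
    simp only [vertex, numLeaves]
    split_ifs <;> simp only [BinaryTree.numLeaves, hP, hQ, hS, add_assoc]

theorem numLeaves_lower (P : RotationPattern) : P.lower.numLeaves = P.numLeaves := by
  rw [← vertex_empty, numLeaves_vertex]

theorem numLeaves_upper (P : RotationPattern) : P.upper.numLeaves = P.numLeaves := by
  rw [← vertex_univ, numLeaves_vertex]

theorem numLeaves_pos (P : RotationPattern) : 0 < P.numLeaves :=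
  P.numLeaves_lower ▸ P.lower.numLeaves_pos

theorem vertex_le_vertex_iff (P : RotationPattern) (a b : Set P.Sites) :
    TamariLE (P.vertex a) (P.vertex b) ↔ a ⊆ b := by
  induction P with
  | leaf => exact iff_of_true .refl fun i => i.elim
  | node P Q hP hQ =>
    rw [vertex, vertex, tamariLE_node_iff (by simp only [numLeaves_vertex]), hP, hQ]
    exact (Sum.forall (p := fun i => i ∈ a → i ∈ b)).symm
  | rot P Q S hP hQ hS =>
    have hab : a ⊆ b ↔ (none ∈ a → none ∈ b) ∧
        ((some ∘ .inl ∘ .inl) ⁻¹' a ⊆ (some ∘ .inl ∘ .inl) ⁻¹' b ∧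
          (some ∘ .inl ∘ .inr) ⁻¹' a ⊆ (some ∘ .inl ∘ .inr) ⁻¹' b) ∧
        (some ∘ .inr) ⁻¹' a ⊆ (some ∘ .inr) ⁻¹' b :=
      Option.forall.trans (and_congr_right' (Sum.forall.trans (and_congr_left' Sum.forall)))
    rw [hab]
    by_cases ha : none ∈ a <;> by_cases hb : none ∈ b <;>
      simp only [vertex, ha, hb, if_true, if_false, true_imp_iff, false_imp_iff, true_and,
        false_and, iff_false]
    · rw [tamariLE_node_iff (by simp only [numLeaves_vertex]),
        tamariLE_node_iff (by simp only [numLeaves_vertex]), hP, hQ, hS, and_assoc]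
    · intro h
      have := numLeaves_le_of_tamariLE_node h
      have := Q.numLeaves_pos
      simp only [BinaryTree.numLeaves, numLeaves_vertex] at *
      omega
    · rw [tamariLE_rotated_iff (by simp only [numLeaves_vertex]),
        tamariLE_node_iff (by simp only [numLeaves_vertex]), hP, hQ, hS, and_assoc]
    · rw [tamariLE_node_iff (by simp only [BinaryTree.numLeaves, numLeaves_vertex]),
        tamariLE_node_iff (by simp only [numLeaves_vertex]), hP, hQ, hS]

theorem lower_le_upper (P : RotationPattern) : TamariLE P.lower P.upper := by
  rw [← vertex_empty, ← vertex_univ, vertex_le_vertex_iff]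
  exact Set.empty_subset _

theorem exists_vertex_eq_iff (P : RotationPattern) (T : BinaryTree Unit) :
    (∃ a, P.vertex a = T) ↔ TamariLE P.lower T ∧ TamariLE T P.upper := by
  constructor
  · rintro ⟨a, rfl⟩
    rw [← vertex_empty, ← vertex_univ, vertex_le_vertex_iff, vertex_le_vertex_iff]
    exact ⟨Set.empty_subset a, Set.subset_univ a⟩
  rintro ⟨hl, hu⟩
  induction P generalizing T with
  | leaf =>
    have hT := numLeaves_eq_of_tamariLE hl
    cases T with
    | nil => exact ⟨∅, rfl⟩
    | node _ L R =>
      have := L.numLeaves_pos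
      have := R.numLeaves_pos
      simp only [lower, BinaryTree.numLeaves] at hT
      omega
  | node P Q hP hQ =>
    obtain ⟨L, R, rfl, hL, hR⟩ :=
      exists_eq_node_of_tamariLE hl hu (by simp only [numLeaves_lower, numLeaves_upper])
    obtain ⟨a, rfl⟩ := hP L hL.1 hL.2
    obtain ⟨b, rfl⟩ := hQ R hR.1 hR.2
    refine ⟨Sum.elim a b, rfl⟩
  | rot P Q S hP hQ hS =>
    obtain ⟨A, B, C, hT, hA, hB, hC⟩ := exists_eq_or_eq_rotated_of_tamariLE hl hu
      (by simp only [numLeaves_lower, numLeaves_upper])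
      (by simp only [numLeaves_lower, numLeaves_upper])
    obtain ⟨a, rfl⟩ := hP A hA.1 hA.2
    obtain ⟨b, rfl⟩ := hQ B hB.1 hB.2
    obtain ⟨c, rfl⟩ := hS C hC.1 hC.2
    rcases hT with rfl | rfl
    · exact ⟨fun i => i.elim False (Sum.elim (Sum.elim a b) c), if_neg id⟩
    · exact ⟨fun i => i.elim True (Sum.elim (Sum.elim a b) c), if_pos trivial⟩

theorem isHypercubeInterval (P : RotationPattern) :
    IsHypercubeInterval (P.lower, P.upper) P.dim := by
  let e : P.Sites ≃ Fin P.dim := Fintype.equivFinOfCardEq P.card_sites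
  let f (s : Finset (Fin P.dim)) : TamariInterval (P.lower, P.upper) :=
    ⟨P.vertex (e ⁻¹' s), (P.exists_vertex_eq_iff _).1 ⟨_, rfl⟩⟩
  have hf (s t : Finset (Fin P.dim)) : TamariLE (f s).1 (f t).1 ↔ s ⊆ t := by
    rw [vertex_le_vertex_iff, e.preimage_subset, Finset.coe_subset]
  have hsurj : Function.Surjective f := by
    rintro ⟨T, hT⟩
    obtain ⟨a, rfl⟩ := (P.exists_vertex_eq_iff T).2 hT
    classical
    refine ⟨(e '' a).toFinset, Subtype.ext ?_⟩
    simp only [f, Set.coe_toFinset, e.preimage_image]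
  have hinj : Function.Injective f := fun s t hst =>
    ((hf s t).1 (hst ▸ .refl)).antisymm ((hf t s).1 (hst ▸ .refl))
  let g : (fun s t : Finset (Fin P.dim) => s ⊆ t) ≃r
      (fun S T : TamariInterval (P.lower, P.upper) => TamariLE S.1 T.1) :=
    ⟨Equiv.ofBijective f ⟨hinj, hsurj⟩, hf _ _⟩
  exact ⟨g.symm⟩

theorem lower_upper_injective :
    Function.Injective fun P : RotationPattern => (P.lower, P.upper) := by
  have node_ne_rot {P Q P' Q' S' : RotationPattern} :
      ¬ ((node P Q).lower = (rot P' Q' S').lower ∧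
        (node P Q).upper = (rot P' Q' S').upper) := by
    rintro ⟨hl, hu⟩
    rw [lower, lower, BinaryTree.node.injEq] at hl
    rw [upper, upper, BinaryTree.node.injEq] at hu
    have hl := congrArg BinaryTree.numLeaves hl.2.1
    have hu := congrArg BinaryTree.numLeaves hu.2.1
    have := Q'.numLeaves_pos
    simp only [BinaryTree.numLeaves, numLeaves_lower, numLeaves_upper] at hl hu
    omega
  intro P P' h
  rw [Prod.mk.injEq] at h
  induction P generalizing P' with
  | leaf => cases P' <;> simp_all only [lower, reduceCtorEq, false_and]
  | node P Q hP hQ =>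
    cases P' with
    | leaf => simp only [lower, reduceCtorEq, false_and] at h
    | node P' Q' =>
      simp only [lower, upper, BinaryTree.node.injEq, true_and] at h
      rw [hP ⟨h.1.1, h.2.1⟩, hQ ⟨h.1.2, h.2.2⟩]
    | rot P' Q' S' => exact absurd h node_ne_rot
  | rot P Q S hP hQ hS =>
    cases P' with
    | leaf => simp only [lower, reduceCtorEq, false_and] at h
    | node P' Q' => exact absurd ⟨h.1.symm, h.2.symm⟩ node_ne_rot
    | rot P' Q' S' =>
      simp only [lower, upper, BinaryTree.node.injEq, true_and] at h
      rw [hP ⟨h.1.1.1, h.2.1⟩, hQ ⟨h.1.1.2, h.2.2.1⟩, hS ⟨h.1.2, h.2.2.2⟩]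

end RotationPattern

theorem eq_of_isHypercubeInterval {I : BinaryTree Unit × BinaryTree Unit} {k l : ℕ}
    (hk : IsHypercubeInterval I k) (hl : IsHypercubeInterval I l) : k = l := by
  obtain ⟨e⟩ := hk
  obtain ⟨f⟩ := hl
  simpa using Fintype.card_congr (e.symm.trans f).toEquiv

section Balance

variable {A L R S T : BinaryTree Unit}

theorem isBalancedTree_node :
    IsBalancedTree (.node () L R) ↔
      (L.height ≤ R.height + 1 ∧ R.height ≤ L.height + 1) ∧
        IsBalancedTree L ∧ IsBalancedTree R := by
  simp only [IsBalancedTree, Set.mem_insert_iff, Set.mem_singleton_iff]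
  exact and_congr_left' (by omega)

/-- Every node has imbalance at least `-1`. Unlike balance, this property is inherited by the two
parts of a cut along the left spine, since such a cut can only raise imbalances. -/
def ImbalanceGeNegOne : BinaryTree Unit → Prop
  | .nil => True
  | .node _ L R => L.height ≤ R.height + 1 ∧ ImbalanceGeNegOne L ∧ ImbalanceGeNegOne R

theorem imbalanceGeNegOne_of_isBalancedTree :
    ∀ {T : BinaryTree Unit}, IsBalancedTree T → ImbalanceGeNegOne T
  | .nil, _ => trivial
  | .node _ _ _, h =>
    have h := isBalancedTree_node.1 h
    ⟨h.1.1, imbalanceGeNegOne_of_isBalancedTree h.2.1, imbalanceGeNegOne_of_isBalancedTree h.2.2⟩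

theorem SpineCut.height_lt (h : SpineCut T A S) : A.height < T.height := by
  induction h with
  | root A B => simp only [BinaryTree.height]; omega
  | left C _ ih => simp only [BinaryTree.height]; omega

theorem SpineCut.height_le (h : SpineCut T A S) : S.height ≤ T.height := by
  induction h with
  | root A B => simp only [BinaryTree.height]; omega
  | left C _ ih => simp only [BinaryTree.height]; omega

theorem SpineCut.imbalanceGeNegOne (h : SpineCut T A S) (hT : ImbalanceGeNegOne T) :
    ImbalanceGeNegOne A ∧ ImbalanceGeNegOne S := by
  induction h with
  | root A B => exact hT.2
  | left C h ih =>
    obtain ⟨hLC, hL, hC⟩ := hT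
    exact ⟨(ih hL).1, h.height_le.trans hLC, (ih hL).2, hC⟩

/-- Cutting at depth three or more would leave a part `S` higher than `A` by at least two. -/
theorem SpineCut.eq_node_or_eq_rotated (h : SpineCut T A S) (hT : ImbalanceGeNegOne T)
    (hle : S.height ≤ A.height + 1) :
    T = .node () A S ∨ ∃ B C, T = .node () (.node () A B) C ∧ S = .node () B C ∧
      A.height = C.height ∧ B.height ≤ A.height ∧ A.height ≤ B.height + 1 := by
  cases h with
  | root => exact .inl rfl
  | left C h =>
    obtain ⟨hLC, hL, -⟩ := hT
    cases h with
    | root =>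
      simp only [ImbalanceGeNegOne, BinaryTree.height] at hLC hL hle
      exact .inr ⟨_, C, rfl, rfl, by omega, by omega, by omega⟩
    | left B h =>
      have hlt := h.height_lt
      simp only [ImbalanceGeNegOne, BinaryTree.height] at hLC hL hle
      omega

/-- The root is a node of imbalance `-1`. -/
def LeftHeavy : BinaryTree Unit → Prop
  | .nil => False
  | .node _ L R => L.height = R.height + 1

/-- The root is a node of imbalance `1`. -/
def RightHeavy : BinaryTree Unit → Prop
  | .nil => False
  | .node _ L R => R.height = L.height + 1

end Balance

namespace RotationPattern

variable {P Q S : RotationPattern}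

/-- The height of the tree `lower`; for a balanced pattern all its trees have this height. -/
def height (P : RotationPattern) : ℕ := P.lower.height

/-- The rotations of the pattern are rotations between balanced trees. -/
def IsBalanced : RotationPattern → Prop
  | leaf => True
  | node P Q =>
    (P.height ≤ Q.height + 1 ∧ Q.height ≤ P.height + 1) ∧ P.IsBalanced ∧ Q.IsBalanced
  | rot P Q S =>
    (P.height = S.height ∧ Q.height ≤ P.height ∧ P.height ≤ Q.height + 1) ∧
      P.IsBalanced ∧ Q.IsBalanced ∧ S.IsBalanced

theorem height_node : (node P Q).height = max P.height Q.height + 1 := rfl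

theorem height_rot :
    (rot P Q S).height = max (max P.height Q.height + 1) S.height + 1 := rfl

theorem IsBalanced.height_upper (hP : P.IsBalanced) : P.upper.height = P.height := by
  induction P with
  | leaf => rfl
  | node P Q ihP ihQ =>
    simp only [upper, height_node, BinaryTree.height, ihP hP.2.1, ihQ hP.2.2]
  | rot P Q S ihP ihQ ihS =>
    obtain ⟨hh, hP, hQ, hS⟩ := hP
    simp only [upper, height_rot, BinaryTree.height, ihP hP, ihQ hQ, ihS hS]
    omega

theorem exists_isBalanced_of_tamariLE {T₀ T₁ : BinaryTree Unit} (h₀ : ImbalanceGeNegOne T₀)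
    (h₁ : IsBalancedTree T₁) (h : TamariLE T₀ T₁) :
    ∃ P : RotationPattern, P.IsBalanced ∧ P.lower = T₀ ∧ P.upper = T₁ := by
  induction T₁ generalizing T₀ with
  | nil =>
    have hn := numLeaves_eq_of_tamariLE h
    cases T₀ with
    | nil => exact ⟨leaf, trivial, rfl, rfl⟩
    | node _ L R =>
      have := L.numLeaves_pos
      have := R.numLeaves_pos
      simp only [BinaryTree.numLeaves] at hn
      omega
  | node _ L R ihL ihR =>
    obtain ⟨⟨hLR, hRL⟩, hL, hR⟩ := isBalancedTree_node.1 h₁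
    obtain ⟨A, S, hcut, hAL, hSR⟩ := exists_spineCut_of_tamariLE_node h
    obtain ⟨hA, hS⟩ := hcut.imbalanceGeNegOne h₀
    obtain ⟨P, hP, rfl, rfl⟩ := ihL hA hL hAL
    obtain ⟨Q, hQ, rfl, rfl⟩ := ihR hS hR hSR
    rw [hP.height_upper, hQ.height_upper] at hLR hRL
    rcases hcut.eq_node_or_eq_rotated h₀ hRL with rfl | ⟨B, C, rfl, hBC, hAC, hBA, hAB⟩
    · exact ⟨node P Q, ⟨⟨hLR, hRL⟩, hP, hQ⟩, rfl, rfl⟩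
    · cases Q with
      | leaf => cases hBC
      | node Q S =>
        cases hBC
        exact ⟨rot P Q S, ⟨⟨hAC, hBA, hAB⟩, hP, hQ.2⟩, rfl, rfl⟩
      | rot X Y Z =>
        cases hBC
        obtain ⟨⟨hXZ, -⟩, -⟩ := hQ
        have hXZ : X.lower.height = Z.lower.height := hXZ
        simp only [BinaryTree.height] at hBA
        omega

end RotationPattern

section Extremal

variable {L R T₀ T₁ : BinaryTree Unit}

theorem height_eq_of_tamariLE (h₀ : IsBalancedTree T₀) (h₁ : IsBalancedTree T₁)
    (h : TamariLE T₀ T₁) : T₁.height = T₀.height := by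
  obtain ⟨P, hP, rfl, rfl⟩ := RotationPattern.exists_isBalanced_of_tamariLE
    (imbalanceGeNegOne_of_isBalancedTree h₀) h₁ h
  exact hP.height_upper

theorem isMinimalBalanced_node :
    IsMinimalBalanced (.node () L R) ↔
      (L.height ≤ R.height + 1 ∧ R.height ≤ L.height + 1) ∧ IsMinimalBalanced L ∧
        IsMinimalBalanced R ∧ (R.height = L.height + 1 → LeftHeavy R) := by
  constructor
  · rintro ⟨hb, hmin⟩
    obtain ⟨hLR, hL, hR⟩ := isBalancedTree_node.1 hb
    refine ⟨hLR, ⟨hL, fun T hr hT => hmin _ (.left _ hr) ?_⟩,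
      ⟨hR, fun T hr hT => hmin _ (.right _ hr) ?_⟩, fun hRL => ?_⟩
    · rw [height_eq_of_tamariLE hT hL (.single hr)] at hLR
      exact isBalancedTree_node.2 ⟨hLR, hT, hR⟩
    · rw [height_eq_of_tamariLE hT hR (.single hr)] at hLR
      exact isBalancedTree_node.2 ⟨hLR, hL, hT⟩
    · rcases R with _ | ⟨_, B, C⟩
      · cases hRL
      · by_contra hheavy
        obtain ⟨hBC, hB, hC⟩ := isBalancedTree_node.1 hR
        refine hmin _ (.root L B C) ?_
        simp only [LeftHeavy, isBalancedTree_node, BinaryTree.height] at hheavy hRL ⊢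
        exact ⟨by omega, ⟨by omega, hL, hB⟩, hC⟩
  · rintro ⟨hLR, hL, hR, hheavy⟩
    refine ⟨isBalancedTree_node.2 ⟨hLR, hL.1, hR.1⟩, fun T hr hT => ?_⟩
    cases hr with
    | root A B C =>
      simp only [LeftHeavy, isBalancedTree_node, BinaryTree.height] at *
      omega
    | left _ hr => exact hL.2 _ hr (isBalancedTree_node.1 hT).2.1
    | right _ hr => exact hR.2 _ hr (isBalancedTree_node.1 hT).2.2

theorem isMaximalBalanced_node :
    IsMaximalBalanced (.node () L R) ↔
      (L.height ≤ R.height + 1 ∧ R.height ≤ L.height + 1) ∧ IsMaximalBalanced L ∧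
        IsMaximalBalanced R ∧ (L.height = R.height + 1 → RightHeavy L) := by
  constructor
  · rintro ⟨hb, hmax⟩
    obtain ⟨hLR, hL, hR⟩ := isBalancedTree_node.1 hb
    refine ⟨hLR, ⟨hL, fun T hr hT => hmax _ (.left _ hr) ?_⟩,
      ⟨hR, fun T hr hT => hmax _ (.right _ hr) ?_⟩, fun hLR' => ?_⟩
    · rw [← height_eq_of_tamariLE hL hT (.single hr)] at hLR
      exact isBalancedTree_node.2 ⟨hLR, hT, hR⟩
    · rw [← height_eq_of_tamariLE hR hT (.single hr)] at hLR
      exact isBalancedTree_node.2 ⟨hLR, hL, hT⟩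
    · rcases L with _ | ⟨_, A, B⟩
      · cases hLR'
      · by_contra hheavy
        obtain ⟨hAB, hA, hB⟩ := isBalancedTree_node.1 hL
        refine hmax _ (.root A B R) ?_
        simp only [RightHeavy, isBalancedTree_node, BinaryTree.height] at hheavy hLR' ⊢
        exact ⟨by omega, hA, by omega, hB, hR⟩
  · rintro ⟨hLR, hL, hR, hheavy⟩
    refine ⟨isBalancedTree_node.2 ⟨hLR, hL.1, hR.1⟩, fun T hr hT => ?_⟩
    cases hr with
    | root A B C =>
      simp only [RightHeavy, isBalancedTree_node, BinaryTree.height] at *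
      omega
    | left _ hr => exact hL.2 _ hr (isBalancedTree_node.1 hT).2.1
    | right _ hr => exact hR.2 _ hr (isBalancedTree_node.1 hT).2.2

end Extremal

namespace RotationPattern

variable {P Q S : RotationPattern}

/-- The balanced patterns of the maximal balanced intervals. -/
def IsMaximal (P : RotationPattern) : Prop :=
  P.IsBalanced ∧ IsMinimalBalanced P.lower ∧ IsMaximalBalanced P.upper

theorem isMaximal_leaf : leaf.IsMaximal :=
  ⟨trivial, ⟨trivial, nofun⟩, ⟨trivial, nofun⟩⟩

theorem isMaximal_node :
    (node P Q).IsMaximal ↔ P.IsMaximal ∧ Q.IsMaximal ∧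
      (P.height ≤ Q.height + 1 ∧ Q.height ≤ P.height + 1) ∧
      (Q.height = P.height + 1 → LeftHeavy Q.lower) ∧
      (P.height = Q.height + 1 → RightHeavy P.upper) := by
  simp only [IsMaximal, IsBalanced, lower, upper, isMinimalBalanced_node, isMaximalBalanced_node]
  constructor
  · rintro ⟨⟨hPQ, hP, hQ⟩, ⟨-, hPl, hQl, hleft⟩, -, hPu, hQu, hright⟩
    rw [hP.height_upper, hQ.height_upper] at hright
    exact ⟨⟨hP, hPl, hPu⟩, ⟨hQ, hQl, hQu⟩, hPQ, hleft, hright⟩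
  · rintro ⟨⟨hP, hPl, hPu⟩, ⟨hQ, hQl, hQu⟩, hPQ, hleft, hright⟩
    rw [hP.height_upper, hQ.height_upper]
    exact ⟨⟨hPQ, hP, hQ⟩, ⟨hPQ, hPl, hQl, hleft⟩, hPQ, hPu, hQu, hright⟩

theorem isMaximal_rot :
    (rot P Q S).IsMaximal ↔ P.IsMaximal ∧ Q.IsMaximal ∧ S.IsMaximal ∧
      P.height = S.height ∧ Q.height ≤ P.height ∧ P.height ≤ Q.height + 1 := by
  simp only [IsMaximal, IsBalanced, lower, upper, isMinimalBalanced_node, isMaximalBalanced_node,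
    BinaryTree.height]
  constructor
  · rintro ⟨⟨hh, hP, hQ, hS⟩, ⟨-, ⟨-, hPl, hQl, -⟩, hSl, -⟩, -, hPu, ⟨-, hQu, hSu, -⟩, -⟩
    exact ⟨⟨hP, hPl, hPu⟩, ⟨hQ, hQl, hQu⟩, ⟨hS, hSl, hSu⟩, hh⟩
  · rintro ⟨⟨hP, hPl, hPu⟩, ⟨hQ, hQl, hQu⟩, ⟨hS, hSl, hSu⟩, hh⟩
    rw [hP.height_upper, hQ.height_upper, hS.height_upper]
    refine ⟨⟨hh, hP, hQ, hS⟩, ⟨?_, ⟨?_, hPl, hQl, ?_⟩, hSl, ?_⟩,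
      ?_, hPu, ⟨?_, hQu, hSu, ?_⟩, ?_⟩ <;> simp only [height] at * <;> omega

theorem isMaximalBalancedInterval_iff {I : BinaryTree Unit × BinaryTree Unit} :
    IsMaximalBalancedInterval I ↔ ∃ P : RotationPattern, P.IsMaximal ∧ (P.lower, P.upper) = I := by
  constructor
  · rintro ⟨hle, hmin, hmax⟩
    obtain ⟨P, hP, hl, hu⟩ := exists_isBalanced_of_tamariLE
      (imbalanceGeNegOne_of_isBalancedTree hmin.1) hmax.1 hle
    exact ⟨P, ⟨hP, hl ▸ hmin, hu ▸ hmax⟩, Prod.ext hl hu⟩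
  · rintro ⟨P, ⟨-, hmin, hmax⟩, rfl⟩
    exact ⟨P.lower_le_upper, hmin, hmax⟩

theorem maximalBalancedIntervals_eq_image (n : ℕ) :
    maximalBalancedIntervals n =
      (fun P : RotationPattern => (P.lower, P.upper)) '' {P | P.IsMaximal ∧ P.numLeaves = n} := by
  ext I
  simp only [maximalBalancedIntervals, Set.mem_image, Set.mem_ofPred_eq,
    isMaximalBalancedInterval_iff]
  constructor
  · rintro ⟨⟨P, hP, rfl⟩, hn, -⟩
    exact ⟨P, ⟨hP, P.numLeaves_lower ▸ hn⟩, rfl⟩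
  · rintro ⟨P, ⟨hP, rfl⟩, rfl⟩
    exact ⟨⟨P, hP, rfl⟩, P.numLeaves_lower, P.numLeaves_upper⟩

end RotationPattern

theorem existsUnique_isHypercubeInterval {I : BinaryTree Unit × BinaryTree Unit}
    (hI : IsMaximalBalancedInterval I) : ∃! k : ℕ, IsHypercubeInterval I k := by
  obtain ⟨P, -, rfl⟩ := RotationPattern.isMaximalBalancedInterval_iff.1 hI
  exact ⟨P.dim, P.isHypercubeInterval, fun k hk =>
    eq_of_isHypercubeInterval hk P.isHypercubeInterval⟩

section WeightedOrder

open MvPowerSeries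

variable {σ R : Type*} [Semiring R]

theorem le_weightedOrder_X (w : σ → ℕ) (i : σ) :
    (w i : ℕ∞) ≤ (X i : MvPowerSeries σ R).weightedOrder w := by
  classical
  refine nat_le_weightedOrder w fun d hd => ?_
  rw [coeff_X, if_neg]
  rintro rfl
  simp [Finsupp.weight_single] at hd

variable {w : σ → ℕ} {f g : MvPowerSeries σ R}

theorem le_weightedOrder_add {n : ℕ∞} (hf : n ≤ f.weightedOrder w)
    (hg : n ≤ g.weightedOrder w) : n ≤ (f + g).weightedOrder w :=
  (le_min hf hg).trans (min_weightedOrder_le_add w)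

theorem le_weightedOrder_mul_of_le {m n k : ℕ} (hf : (m : ℕ∞) ≤ f.weightedOrder w)
    (hg : (n : ℕ∞) ≤ g.weightedOrder w) (h : k ≤ m + n) :
    (k : ℕ∞) ≤ (f * g).weightedOrder w :=
  calc (k : ℕ∞) ≤ (m : ℕ∞) + n := by exact_mod_cast h
    _ ≤ f.weightedOrder w + g.weightedOrder w := add_le_add hf hg
    _ ≤ (f * g).weightedOrder w := le_weightedOrder_mul w

end WeightedOrder

section FunctionalEquation

open MvPowerSeries

open scoped MvPowerSeries.WithPiTopology

variable {σ τ R : Type*} [CommRing R] {v : σ → ℕ} {w : τ → ℕ}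

theorem add_le_weightedOrder_subst {a : σ → MvPowerSeries τ R} (ha : HasSubst a) {e : ℕ}
    (he : ∀ i, ((v i + e : ℕ) : ℕ∞) ≤ (a i).weightedOrder w) {f : MvPowerSeries σ R}
    (hf : constantCoeff f = 0) {n : ℕ} (hn : (n : ℕ∞) ≤ f.weightedOrder v) :
    ((n + e : ℕ) : ℕ∞) ≤ (subst a f).weightedOrder w := by
  refine le_trans (le_iInf₂ fun d hd => ?_) (le_weightedOrder_subst w ha f)
  obtain ⟨i, hi⟩ := Finsupp.ne_iff.1 (show d ≠ 0 from fun h0 => hd (h0 ▸ hf))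
  have hi : i ∈ d.support := Finsupp.mem_support_iff.2 hi
  have hnd : n ≤ ∑ j ∈ d.support, d j * v j := by
    exact_mod_cast hn.trans (weightedOrder_le v hd)
  have hed : e ≤ ∑ j ∈ d.support, d j * e :=
    (Nat.le_mul_of_pos_left e (Nat.pos_of_ne_zero (Finsupp.mem_support_iff.1 hi))).trans
      (Finset.single_le_sum (f := fun j => d j * e) (fun _ _ => Nat.zero_le _) hi)
  calc ((n + e : ℕ) : ℕ∞)
      ≤ (∑ j ∈ d.support, d j * (v j + e) : ℕ) := by
        simp only [mul_add, Finset.sum_add_distrib]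
        exact Nat.cast_le.2 (add_le_add hnd hed)
    _ ≤ Finsupp.weight (weightedOrder w ∘ a) d := by
        rw [Finsupp.weight_apply, Finsupp.sum, Nat.cast_sum]
        refine Finset.sum_le_sum fun j _ => ?_
        rw [Nat.cast_mul, nsmul_eq_mul]
        exact mul_le_mul_right (he j) _

theorem eq_zero_of_forall_le_weightedOrder {f : MvPowerSeries σ R}
    (h : ∀ n : ℕ, (n : ℕ∞) ≤ f.weightedOrder v) : f = 0 :=
  (weightedOrder_eq_top_iff v).1 (ENat.eq_top_iff_forall_ge.2 h)

variable {a : σ → MvPowerSeries σ R} {g S S' : MvPowerSeries σ R}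

theorem constantCoeff_eq_zero_of_lt_weightedOrder
    (hw : ∀ i, ((v i + 1 : ℕ) : ℕ∞) ≤ (a i).weightedOrder v) (i : σ) :
    constantCoeff (a i) = 0 :=
  coeff_eq_zero_of_lt_weightedOrder v <| by
    rw [map_zero]
    exact lt_of_lt_of_le (by exact_mod_cast Nat.succ_pos _) (hw i)

theorem eq_of_eq_add_subst (ha : HasSubst a)
    (hw : ∀ i, ((v i + 1 : ℕ) : ℕ∞) ≤ (a i).weightedOrder v)
    (hS : constantCoeff S = 0) (hS' : constantCoeff S' = 0)
    (h : S = g + subst a S) (h' : S' = g + subst a S') : S = S' := by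
  have hc : constantCoeff (S - S') = 0 := by rw [map_sub, hS, hS', sub_zero]
  have hfix : S - S' = subst a (S - S') := by
    rw [subst_sub ha]
    nth_rewrite 1 [h, h']
    ring
  refine sub_eq_zero.1 (eq_zero_of_forall_le_weightedOrder (v := v) fun n => ?_)
  induction n with
  | zero => exact zero_le
  | succ n ih =>
    rw [hfix]
    exact add_le_weightedOrder_subst ha hw hc ih

theorem constantCoeff_iterate_subst (ha : HasSubst a)
    (hw : ∀ i, ((v i + 1 : ℕ) : ℕ∞) ≤ (a i).weightedOrder v)
    (hg : constantCoeff g = 0) (h : ℕ) : constantCoeff ((subst a)^[h] g) = 0 := by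
  induction h with
  | zero => exact hg
  | succ h ih =>
    rw [Function.iterate_succ_apply']
    exact constantCoeff_subst_eq_zero ha (constantCoeff_eq_zero_of_lt_weightedOrder hw) ih

theorem le_weightedOrder_iterate_subst (ha : HasSubst a)
    (hw : ∀ i, ((v i + 1 : ℕ) : ℕ∞) ≤ (a i).weightedOrder v)
    (hg : constantCoeff g = 0) (h : ℕ) : (h : ℕ∞) ≤ ((subst a)^[h] g).weightedOrder v := by
  induction h with
  | zero => exact zero_le
  | succ h ih =>
    rw [Function.iterate_succ_apply']
    exact add_le_weightedOrder_subst ha hw (constantCoeff_iterate_subst ha hw hg h) ih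

section Topology

variable [UniformSpace R]

theorem summable_iterate_subst (ha : HasSubst a)
    (hw : ∀ i, ((v i + 1 : ℕ) : ℕ∞) ≤ (a i).weightedOrder v)
    (hg : constantCoeff g = 0) : Summable fun h : ℕ => (subst a)^[h] g :=
  WithPiTopology.summable_of_tendsto_weightedOrder_atTop_nhds_top <|
    ENat.tendsto_nhds_top_iff_natCast_lt.2 fun n =>
      (Filter.eventually_gt_atTop n).mono fun h hnh =>
        (Nat.cast_lt.2 hnh).trans_le (le_weightedOrder_iterate_subst ha hw hg h)

variable [DiscreteUniformity R]

theorem tsum_iterate_subst (ha : HasSubst a)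
    (hw : ∀ i, ((v i + 1 : ℕ) : ℕ∞) ≤ (a i).weightedOrder v) (hg : constantCoeff g = 0) :
    constantCoeff (∑' h : ℕ, (subst a)^[h] g) = 0 ∧
      ∑' h : ℕ, (subst a)^[h] g = g + subst a (∑' h : ℕ, (subst a)^[h] g) := by
  have hsum := summable_iterate_subst ha hw hg
  constructor
  · rw [hsum.map_tsum _ (WithPiTopology.continuous_constantCoeff R)]
    simp only [constantCoeff_iterate_subst ha hw hg, tsum_zero]
  · rw [subst_tsum hsum ha]
    simp only [← Function.iterate_succ_apply' (subst a)]
    exact hsum.tsum_eq_zero_add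

theorem hasSum_coeff_subst_iterate_subst (ha : HasSubst a)
    (hw : ∀ i, ((v i + 1 : ℕ) : ℕ∞) ≤ (a i).weightedOrder v) (hg : constantCoeff g = 0)
    (hS : constantCoeff S = 0) (h : S = g + subst a S) {b : σ → MvPowerSeries τ R}
    (hb : HasSubst b) (d : τ →₀ ℕ) :
    HasSum (fun h => coeff d (subst b ((subst a)^[h] g))) (coeff d (subst b S)) := by
  obtain ⟨hS', h'⟩ := tsum_iterate_subst ha hw hg
  have hsum := (summable_iterate_subst ha hw hg).hasSum
  rw [← eq_of_eq_add_subst ha hw hS hS' h h'] at hsum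
  have hcont : Continuous (substAlgHom (R := R) hb) :=
    coe_substAlgHom (R := R) hb ▸ continuous_subst hb
  simpa only [Function.comp_def, coe_substAlgHom] using
    (hsum.map (substAlgHom hb) hcont).map (coeff d) (WithPiTopology.continuous_coeff R d)

end Topology

theorem existsUnique_eq_add_subst (ha : HasSubst a)
    (hw : ∀ i, ((v i + 1 : ℕ) : ℕ∞) ≤ (a i).weightedOrder v) (hg : constantCoeff g = 0) :
    ∃! S : MvPowerSeries σ R, constantCoeff S = 0 ∧ S = g + subst a S :=
  letI : UniformSpace R := ⊥
  ⟨_, tsum_iterate_subst ha hw hg, fun _ hS =>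
    have hT := tsum_iterate_subst ha hw hg
    eq_of_eq_add_subst ha hw hS.1 hT.1 hS.2 hT.2⟩

end FunctionalEquation

section MbiSubs

open MvPowerSeries

variable {R : Type} [CommRing R]

/-- Weights of the variables `x`, `y`, `z`, `t` for which `mbiSubs` strictly raises the order. -/
def mbiWeight : Fin 4 → ℕ := ![2, 1, 2, 2]

theorem succ_mbiWeight_le_weightedOrder_mbiSubs (ξ : R) (i : Fin 4) :
    ((mbiWeight i + 1 : ℕ) : ℕ∞) ≤ (mbiSubs ξ i).weightedOrder mbiWeight := by
  have hx := le_weightedOrder_X (R := R) mbiWeight 0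
  have hy := le_weightedOrder_X (R := R) mbiWeight 1
  have hz := le_weightedOrder_X (R := R) mbiWeight 2
  have ht := le_weightedOrder_X (R := R) mbiWeight 3
  have hxx := le_weightedOrder_mul_of_le hx hx (k := 3) (by decide)
  have hxy := le_weightedOrder_mul_of_le hx hy (k := 3) (by decide)
  have hyt := le_weightedOrder_mul_of_le hy ht (k := 3) (by decide)
  have h2yt := le_weightedOrder_mul_of_le (f := 2) (m := 0) zero_le hyt (k := 3) (by decide)
  have hyzξ := le_weightedOrder_mul_of_le (le_weightedOrder_mul_of_le hy hz le_rfl)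
    (g := C ξ) (n := 0) zero_le (k := 3) (by decide)
  rw [← pow_two] at hxx
  rw [← mul_assoc] at h2yt
  fin_cases i
  · exact le_weightedOrder_add (le_weightedOrder_add hxx h2yt) hyzξ
  · exact hx
  · exact le_weightedOrder_add hxx hxy
  · exact le_weightedOrder_add hyt hyzξ

theorem existsUnique_isMbiSolution (ξ : R) : ∃! S : MvPowerSeries (Fin 4) R, IsMbiSolution ξ S :=
  existsUnique_eq_add_subst (hasSubst_mbiSubs ξ) (succ_mbiWeight_le_weightedOrder_mbiSubs ξ)
    (constantCoeff_X 0)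

/-- The orbit of the point `(x, 0, 0, 0)` under the substitution `mbiSubs`: evaluation of series
in `x`, `y`, `z`, `t` at the `h`-th point of the orbit. -/
noncomputable def mbiOrbit (ξ : R) (h : ℕ) : MvPowerSeries (Fin 4) R →ₐ[R] PowerSeries R :=
  (substAlgHom (hasSubst_mbiPoint R)).comp (substAlgHom (hasSubst_mbiSubs ξ) ^ h)

theorem mbiOrbit_zero_X (ξ : R) (i : Fin 4) : mbiOrbit ξ 0 (X i) = mbiPoint R i :=
  substAlgHom_X (hasSubst_mbiPoint R) i

theorem mbiOrbit_succ_X (ξ : R) (h : ℕ) (i : Fin 4) :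
    mbiOrbit ξ (h + 1) (X i) = mbiOrbit ξ h (mbiSubs ξ i) := by
  rw [mbiOrbit, mbiOrbit, pow_succ, AlgHom.comp_apply, AlgHom.comp_apply, AlgHom.mul_apply,
    substAlgHom_X]

theorem hasSum_coeff_mbiOrbit [UniformSpace R] [DiscreteUniformity R] {ξ : R}
    {S : MvPowerSeries (Fin 4) R} (hS : IsMbiSolution ξ S) (n : ℕ) :
    HasSum (fun h => PowerSeries.coeff n (mbiOrbit ξ h (X 0)))
      (PowerSeries.coeff n (mbiSpecialize S)) := by
  simp only [mbiOrbit, AlgHom.comp_apply, AlgHom.coe_pow, coe_substAlgHom]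
  exact hasSum_coeff_subst_iterate_subst (hasSubst_mbiSubs ξ)
    (succ_mbiWeight_le_weightedOrder_mbiSubs ξ) (constantCoeff_X 0) hS.1 hS.2 (hasSubst_mbiPoint R)
    (Finsupp.single () n)

end MbiSubs

namespace RotationPattern

variable {P Q S : RotationPattern} {ℓ : ℕ}

theorem finite_setOf_height_lt (ℓ : ℕ) : {P : RotationPattern | P.height < ℓ}.Finite := by
  induction ℓ with
  | zero => simp
  | succ ℓ ih =>
    refine ((Set.finite_singleton leaf).union ((ih.image2 node ih).union
      (ih.image2 (fun P (q : RotationPattern × RotationPattern) => rot P q.1 q.2)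
        (ih.prod ih)))).subset fun P hP => ?_
    have hP : P.height < ℓ + 1 := hP
    cases P with
    | leaf => exact .inl rfl
    | node P Q =>
      rw [height_node] at hP
      exact .inr (.inl ⟨P, show P.height < ℓ by omega, Q, show Q.height < ℓ by omega, rfl⟩)
    | rot P Q S =>
      rw [height_rot] at hP
      exact .inr (.inr ⟨P, show P.height < ℓ by omega, (Q, S),
        ⟨show Q.height < ℓ by omega, show S.height < ℓ by omega⟩, rfl⟩)

theorem finite_setOf_isMaximal_level (ℓ : ℕ) :
    {P : RotationPattern | P.IsMaximal ∧ P.height + 1 = ℓ}.Finite :=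
  (finite_setOf_height_lt ℓ).subset fun _ hP => hP.2.le

/-- The patterns of the maximal balanced intervals on level `ℓ`, that is, of height `ℓ - 1`. The
shift makes room for the empty level `0`, which corresponds to the initial values `0` of the
orbit of `(x, 0, 0, 0)`. -/
noncomputable def maximalOfLevel (ℓ : ℕ) : Finset RotationPattern :=
  (finite_setOf_isMaximal_level ℓ).toFinset

theorem mem_maximalOfLevel : P ∈ maximalOfLevel ℓ ↔ P.IsMaximal ∧ P.height + 1 = ℓ :=
  Set.Finite.mem_toFinset _

theorem finite_setOf_isMaximal_numLeaves (n : ℕ) :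
    {P : RotationPattern | P.IsMaximal ∧ P.numLeaves = n}.Finite :=
  .of_finite_image (maximalBalancedIntervals_eq_image n ▸ finite_maximalBalancedIntervals n)
    lower_upper_injective.injOn

/-- The patterns of the maximal balanced intervals of trees with `n` leaves. -/
noncomputable def maximalOfNumLeaves (n : ℕ) : Finset RotationPattern :=
  (finite_setOf_isMaximal_numLeaves n).toFinset

theorem coe_maximalOfNumLeaves (n : ℕ) :
    (maximalOfNumLeaves n : Set RotationPattern) = {P | P.IsMaximal ∧ P.numLeaves = n} :=
  Set.Finite.coe_toFinset _

theorem mem_maximalOfNumLeaves {n : ℕ} :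
    P ∈ maximalOfNumLeaves n ↔ P.IsMaximal ∧ P.numLeaves = n :=
  Set.Finite.mem_toFinset _

open Classical in
/-- The patterns of level `ℓ` with which the minimal tree has imbalance `-1` at the root, so that
they may be the higher right subpattern of a `node`. -/
noncomputable def leftHeavyOfLevel (ℓ : ℕ) : Finset RotationPattern :=
  (maximalOfLevel ℓ).filter fun P => LeftHeavy P.lower

open Classical in
/-- The patterns of level `ℓ` with which the maximal tree has imbalance `1` at the root, so that
they may be the higher left subpattern of a `node`. -/
noncomputable def rightHeavyOfLevel (ℓ : ℕ) : Finset RotationPattern :=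
  (maximalOfLevel ℓ).filter fun P => RightHeavy P.upper

theorem mem_leftHeavyOfLevel :
    P ∈ leftHeavyOfLevel ℓ ↔ (P.IsMaximal ∧ P.height + 1 = ℓ) ∧ LeftHeavy P.lower := by
  simp only [leftHeavyOfLevel, Finset.mem_filter, mem_maximalOfLevel]

theorem mem_rightHeavyOfLevel :
    P ∈ rightHeavyOfLevel ℓ ↔ (P.IsMaximal ∧ P.height + 1 = ℓ) ∧ RightHeavy P.upper := by
  simp only [rightHeavyOfLevel, Finset.mem_filter, mem_maximalOfLevel]

theorem maximalOfLevel_zero : maximalOfLevel 0 = ∅ :=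
  Finset.eq_empty_of_forall_notMem fun _ hP => Nat.succ_ne_zero _ (mem_maximalOfLevel.1 hP).2

theorem maximalOfLevel_one : maximalOfLevel 1 = {leaf} := by
  ext P
  rw [mem_maximalOfLevel, Finset.mem_singleton]
  constructor
  · rintro ⟨-, hP⟩
    cases P with
    | leaf => rfl
    | node P Q => rw [height_node] at hP; omega
    | rot P Q S => rw [height_rot] at hP; omega
  · rintro rfl
    exact ⟨isMaximal_leaf, rfl⟩

theorem leftHeavyOfLevel_one : leftHeavyOfLevel 1 = ∅ := by
  rw [leftHeavyOfLevel, maximalOfLevel_one, Finset.filter_singleton]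
  exact if_neg not_false

theorem rightHeavyOfLevel_one : rightHeavyOfLevel 1 = ∅ := by
  rw [rightHeavyOfLevel, maximalOfLevel_one, Finset.filter_singleton]
  exact if_neg not_false

theorem node_mem_maximalOfLevel :
    node P Q ∈ maximalOfLevel (ℓ + 2) ↔
      P ∈ maximalOfLevel (ℓ + 1) ∧ Q ∈ maximalOfLevel (ℓ + 1) ∨
      P ∈ maximalOfLevel ℓ ∧ Q ∈ leftHeavyOfLevel (ℓ + 1) ∨
      P ∈ rightHeavyOfLevel (ℓ + 1) ∧ Q ∈ maximalOfLevel ℓ := by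
  simp only [mem_maximalOfLevel, mem_leftHeavyOfLevel, mem_rightHeavyOfLevel, isMaximal_node,
    height_node]
  grind

theorem node_mem_leftHeavyOfLevel :
    node P Q ∈ leftHeavyOfLevel (ℓ + 2) ↔
      P ∈ rightHeavyOfLevel (ℓ + 1) ∧ Q ∈ maximalOfLevel ℓ := by
  simp only [mem_maximalOfLevel, mem_leftHeavyOfLevel, mem_rightHeavyOfLevel, isMaximal_node,
    height_node]
  change _ ∧ P.height = Q.height + 1 ↔ _
  grind

theorem rightHeavy_upper_node (hP : P.IsBalanced) (hQ : Q.IsBalanced) :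
    RightHeavy (node P Q).upper ↔ Q.height = P.height + 1 := by
  rw [← hP.height_upper, ← hQ.height_upper]
  rfl

theorem node_mem_rightHeavyOfLevel :
    node P Q ∈ rightHeavyOfLevel (ℓ + 2) ↔
      P ∈ maximalOfLevel ℓ ∧ Q ∈ leftHeavyOfLevel (ℓ + 1) := by
  simp only [mem_maximalOfLevel, mem_leftHeavyOfLevel, mem_rightHeavyOfLevel, isMaximal_node,
    height_node]
  constructor
  · rintro ⟨⟨⟨hP, hQ, -, hleft, -⟩, hℓ⟩, hheavy⟩
    have hheavy := (rightHeavy_upper_node hP.1 hQ.1).1 hheavy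
    exact ⟨⟨hP, by omega⟩, ⟨hQ, by omega⟩, hleft hheavy⟩
  · rintro ⟨⟨hP, hPℓ⟩, ⟨hQ, hQℓ⟩, hheavy⟩
    exact ⟨⟨⟨hP, hQ, by omega, fun _ => hheavy, by omega⟩, by omega⟩,
      (rightHeavy_upper_node hP.1 hQ.1).2 (by omega)⟩

theorem rot_mem_maximalOfLevel :
    rot P Q S ∈ maximalOfLevel (ℓ + 2) ↔
      P ∈ maximalOfLevel ℓ ∧ (Q ∈ maximalOfLevel ℓ ∨ Q ∈ maximalOfLevel (ℓ - 1)) ∧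
        S ∈ maximalOfLevel ℓ := by
  simp only [mem_maximalOfLevel, isMaximal_rot, height_rot]
  grind

theorem rot_mem_leftHeavyOfLevel :
    rot P Q S ∈ leftHeavyOfLevel ℓ ↔ rot P Q S ∈ maximalOfLevel ℓ := by
  rw [mem_leftHeavyOfLevel, mem_maximalOfLevel, and_iff_left_iff_imp, isMaximal_rot]
  rintro ⟨⟨-, -, -, hPS, hQP, -⟩, -⟩
  change max P.height Q.height + 1 = S.height + 1
  omega

theorem rot_mem_rightHeavyOfLevel :
    rot P Q S ∈ rightHeavyOfLevel ℓ ↔ rot P Q S ∈ maximalOfLevel ℓ := by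
  rw [mem_rightHeavyOfLevel, mem_maximalOfLevel, and_iff_left_iff_imp, isMaximal_rot]
  rintro ⟨⟨hP, hQ, hS, hPS, hQP, -⟩, -⟩
  change max Q.upper.height S.upper.height + 1 = P.upper.height + 1
  rw [hP.1.height_upper, hQ.1.height_upper, hS.1.height_upper]
  omega

section GeneratingSeries

variable {R : Type*} [CommRing R]

/-- The monomial that records the number of leaves, and the dimension as a power of `ξ`. -/
noncomputable def weight (ξ : R) (P : RotationPattern) : PowerSeries R :=
  PowerSeries.monomial P.numLeaves (ξ ^ P.dim)

/-- The generating series of a finite set of patterns. -/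
noncomputable def genSeries (ξ : R) (s : Finset RotationPattern) : PowerSeries R :=
  ∑ P ∈ s, weight ξ P

theorem weight_node (ξ : R) : weight ξ (node P Q) = weight ξ P * weight ξ Q := by
  rw [weight, weight, weight, PowerSeries.monomial_mul_monomial, ← pow_add]
  rfl

theorem weight_rot (ξ : R) :
    weight ξ (rot P Q S) = weight ξ P * weight ξ Q * weight ξ S * PowerSeries.C ξ := by
  rw [weight, weight, weight, weight, ← PowerSeries.monomial_zero_eq_C_apply,
    PowerSeries.monomial_mul_monomial, PowerSeries.monomial_mul_monomial,
    PowerSeries.monomial_mul_monomial, ← pow_add, ← pow_add, ← pow_succ]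
  rfl

theorem sum_weight_node (ξ : R) (s t : Finset RotationPattern) :
    ∑ p ∈ s ×ˢ t, weight ξ (node p.1 p.2) = genSeries ξ s * genSeries ξ t := by
  simp only [weight_node, genSeries, Finset.sum_product, ← Finset.mul_sum, ← Finset.sum_mul]

theorem sum_weight_rot (ξ : R) (s t u : Finset RotationPattern) :
    ∑ p ∈ s ×ˢ t ×ˢ u, weight ξ (rot p.1 p.2.1 p.2.2) =
      genSeries ξ s * genSeries ξ t * genSeries ξ u * PowerSeries.C ξ := by
  simp only [weight_rot, genSeries, Finset.sum_product, ← Finset.mul_sum, ← Finset.sum_mul]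

theorem genSeries_eq_add (ξ : R) {s : Finset RotationPattern}
    {N : Finset (RotationPattern × RotationPattern)}
    {T : Finset (RotationPattern × RotationPattern × RotationPattern)} (hleaf : leaf ∉ s)
    (hN : ∀ P Q, node P Q ∈ s ↔ (P, Q) ∈ N) (hT : ∀ P Q S, rot P Q S ∈ s ↔ (P, Q, S) ∈ T) :
    genSeries ξ s = ∑ p ∈ N, weight ξ (node p.1 p.2) +
      ∑ p ∈ T, weight ξ (rot p.1 p.2.1 p.2.2) := by
  let f : RotationPattern × RotationPattern ⊕ RotationPattern × RotationPattern × RotationPattern →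
      RotationPattern := Sum.elim (fun p => node p.1 p.2) fun p => rot p.1 p.2.1 p.2.2
  refine Eq.trans (Finset.sum_nbij f ?_ ?_ ?_ fun _ _ => rfl).symm
    (Finset.sum_disjSum N T fun p => weight ξ (f p))
  · rintro (p | p) hp
    · exact (hN _ _).2 (Finset.inl_mem_disjSum.1 hp)
    · exact (hT _ _ _).2 (Finset.inr_mem_disjSum.1 hp)
  · rintro (⟨P, Q⟩ | ⟨P, Q, S⟩) - (⟨P', Q'⟩ | ⟨P', Q', S'⟩) - h <;> cases h <;> rfl
  · rintro (_ | ⟨P, Q⟩ | ⟨P, Q, S⟩) h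
    · exact absurd h hleaf
    · exact ⟨.inl (P, Q), Finset.inl_mem_disjSum.2 ((hN P Q).1 h), rfl⟩
    · exact ⟨.inr (P, Q, S), Finset.inr_mem_disjSum.2 ((hT P Q S).1 h), rfl⟩

theorem disjoint_maximalOfLevel_pred (ℓ : ℕ) :
    Disjoint (maximalOfLevel ℓ) (maximalOfLevel (ℓ - 1)) := by
  refine Finset.disjoint_left.2 fun P hP hP' => ?_
  rw [mem_maximalOfLevel] at hP hP'
  omega

open Classical in
/-- The triples of subpatterns of the `rot`s of level `ℓ + 2`. -/
noncomputable def rotTriples (ℓ : ℕ) :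
    Finset (RotationPattern × RotationPattern × RotationPattern) :=
  maximalOfLevel ℓ ×ˢ (maximalOfLevel ℓ ∪ maximalOfLevel (ℓ - 1)) ×ˢ maximalOfLevel ℓ

theorem rot_mem_maximalOfLevel_iff_mem_rotTriples (P Q S : RotationPattern) :
    rot P Q S ∈ maximalOfLevel (ℓ + 2) ↔ (P, Q, S) ∈ rotTriples ℓ := by
  simp only [rotTriples, rot_mem_maximalOfLevel, Finset.mem_product, Finset.mem_union]

theorem sum_rotTriples (ξ : R) (ℓ : ℕ) :
    ∑ p ∈ rotTriples ℓ, weight ξ (rot p.1 p.2.1 p.2.2) =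
      genSeries ξ (maximalOfLevel ℓ) *
        (genSeries ξ (maximalOfLevel ℓ) + genSeries ξ (maximalOfLevel (ℓ - 1))) *
        genSeries ξ (maximalOfLevel ℓ) * PowerSeries.C ξ := by
  classical
  rw [rotTriples, sum_weight_rot]
  simp only [genSeries, Finset.sum_union (disjoint_maximalOfLevel_pred ℓ)]

theorem leaf_notMem_maximalOfLevel (ℓ : ℕ) : leaf ∉ maximalOfLevel (ℓ + 2) := fun h =>
  absurd (Nat.succ.inj (mem_maximalOfLevel.1 h).2) (Nat.succ_ne_zero ℓ).symm

theorem genSeries_leftHeavyOfLevel_add_two (ξ : R) (ℓ : ℕ) :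
    genSeries ξ (leftHeavyOfLevel (ℓ + 2)) =
      genSeries ξ (rightHeavyOfLevel (ℓ + 1)) * genSeries ξ (maximalOfLevel ℓ) +
        ∑ p ∈ rotTriples ℓ, weight ξ (rot p.1 p.2.1 p.2.2) := by
  rw [← sum_weight_node]
  refine genSeries_eq_add ξ (fun h => (mem_leftHeavyOfLevel.1 h).2) (fun P Q => ?_) fun P Q S => ?_
  · rw [node_mem_leftHeavyOfLevel, Finset.mem_product]
  · rw [rot_mem_leftHeavyOfLevel, rot_mem_maximalOfLevel_iff_mem_rotTriples]

theorem genSeries_rightHeavyOfLevel_add_two (ξ : R) (ℓ : ℕ) :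
    genSeries ξ (rightHeavyOfLevel (ℓ + 2)) =
      genSeries ξ (maximalOfLevel ℓ) * genSeries ξ (leftHeavyOfLevel (ℓ + 1)) +
        ∑ p ∈ rotTriples ℓ, weight ξ (rot p.1 p.2.1 p.2.2) := by
  rw [← sum_weight_node]
  refine genSeries_eq_add ξ (fun h => (mem_rightHeavyOfLevel.1 h).2) (fun P Q => ?_)
    fun P Q S => ?_
  · rw [node_mem_rightHeavyOfLevel, Finset.mem_product]
  · rw [rot_mem_rightHeavyOfLevel, rot_mem_maximalOfLevel_iff_mem_rotTriples]

theorem genSeries_rightHeavyOfLevel (ξ : R) (ℓ : ℕ) :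
    genSeries ξ (rightHeavyOfLevel (ℓ + 1)) = genSeries ξ (leftHeavyOfLevel (ℓ + 1)) := by
  induction ℓ with
  | zero => rw [rightHeavyOfLevel_one, leftHeavyOfLevel_one]
  | succ ℓ ih =>
    rw [genSeries_rightHeavyOfLevel_add_two, genSeries_leftHeavyOfLevel_add_two, ih, mul_comm]

theorem genSeries_maximalOfLevel_add_two (ξ : R) (ℓ : ℕ) :
    genSeries ξ (maximalOfLevel (ℓ + 2)) =
      genSeries ξ (maximalOfLevel (ℓ + 1)) * genSeries ξ (maximalOfLevel (ℓ + 1)) +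
        (genSeries ξ (maximalOfLevel ℓ) * genSeries ξ (leftHeavyOfLevel (ℓ + 1)) +
          genSeries ξ (rightHeavyOfLevel (ℓ + 1)) * genSeries ξ (maximalOfLevel ℓ)) +
        ∑ p ∈ rotTriples ℓ, weight ξ (rot p.1 p.2.1 p.2.2) := by
  classical
  have hdisj : Disjoint (maximalOfLevel (ℓ + 1)) (maximalOfLevel ℓ) :=
    disjoint_maximalOfLevel_pred (ℓ + 1)
  have hr : rightHeavyOfLevel (ℓ + 1) ⊆ maximalOfLevel (ℓ + 1) := Finset.filter_subset _ _
  rw [← sum_weight_node, ← sum_weight_node, ← sum_weight_node,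
    ← Finset.sum_union, ← Finset.sum_union]
  · refine genSeries_eq_add ξ (leaf_notMem_maximalOfLevel ℓ) (fun P Q => ?_)
      rot_mem_maximalOfLevel_iff_mem_rotTriples
    simp only [node_mem_maximalOfLevel, Finset.mem_union, Finset.mem_product]
  · exact Finset.disjoint_union_right.2 ⟨Finset.disjoint_product.2 (.inl hdisj),
      Finset.disjoint_product.2 (.inr hdisj)⟩
  · exact Finset.disjoint_product.2 (.inl (hdisj.symm.mono_right hr))

end GeneratingSeries

end RotationPattern

open RotationPattern

section Coefficients

open MvPowerSeries

variable {R : Type} [CommRing R]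

/-- At `h = 0` the truncated subtraction is harmless, since level `0` is empty. -/
theorem mbiOrbit_X (ξ : R) (h : ℕ) (i : Fin 4) :
    mbiOrbit ξ h (X i) =
      ![genSeries ξ (maximalOfLevel (h + 1)),
        genSeries ξ (maximalOfLevel h),
        genSeries ξ (maximalOfLevel h) *
          (genSeries ξ (maximalOfLevel h) + genSeries ξ (maximalOfLevel (h - 1))),
        genSeries ξ (leftHeavyOfLevel (h + 1))] i := by
  induction h generalizing i with
  | zero =>
    rw [mbiOrbit_zero_X, maximalOfLevel_one, maximalOfLevel_zero, leftHeavyOfLevel_one]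
    fin_cases i <;> simp [mbiPoint, genSeries, weight, numLeaves, dim, PowerSeries.X_eq]
  | succ h ih =>
    have hx : mbiOrbit ξ h (X 0) = genSeries ξ (maximalOfLevel (h + 1)) := ih 0
    have hy : mbiOrbit ξ h (X 1) = genSeries ξ (maximalOfLevel h) := ih 1
    have hz : mbiOrbit ξ h (X 2) = genSeries ξ (maximalOfLevel h) *
        (genSeries ξ (maximalOfLevel h) + genSeries ξ (maximalOfLevel (h - 1))) := ih 2
    have ht : mbiOrbit ξ h (X 3) = genSeries ξ (leftHeavyOfLevel (h + 1)) := ih 3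
    have hξ : mbiOrbit ξ h (C ξ) = PowerSeries.C ξ := (mbiOrbit ξ h).commutes ξ
    rw [mbiOrbit_succ_X]
    fin_cases i
    · change mbiOrbit ξ h (X 0 ^ 2 + 2 * X 1 * X 3 + X 1 * X 2 * C ξ) =
        genSeries ξ (maximalOfLevel (h + 2))
      rw [genSeries_maximalOfLevel_add_two, genSeries_rightHeavyOfLevel, sum_rotTriples]
      simp only [map_add, map_mul, map_pow, map_ofNat, hx, hy, hz, ht, hξ]
      ring
    · exact hx
    · change mbiOrbit ξ h (X 0 ^ 2 + X 0 * X 1) = genSeries ξ (maximalOfLevel (h + 1)) *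
        (genSeries ξ (maximalOfLevel (h + 1)) + genSeries ξ (maximalOfLevel h))
      rw [map_add, map_pow, map_mul, hx, hy, mul_add, sq]
    · change mbiOrbit ξ h (X 1 * X 3 + X 1 * X 2 * C ξ) = genSeries ξ (leftHeavyOfLevel (h + 2))
      rw [genSeries_leftHeavyOfLevel_add_two, genSeries_rightHeavyOfLevel, sum_rotTriples]
      simp only [map_add, map_mul, hy, hz, ht, hξ]
      ring

theorem hasSum_coeff_genSeries_maximalOfLevel [TopologicalSpace R] [ContinuousAdd R] (ξ : R)
    (n : ℕ) :
    HasSum (fun h => PowerSeries.coeff n (genSeries ξ (maximalOfLevel (h + 1))))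
      (∑ P ∈ maximalOfNumLeaves n, ξ ^ P.dim) := by
  have hcoeff (h : ℕ) : PowerSeries.coeff n (genSeries ξ (maximalOfLevel (h + 1))) =
      ∑ P ∈ maximalOfNumLeaves n, if h = P.height then ξ ^ P.dim else 0 := by
    simp only [genSeries, weight, map_sum, PowerSeries.coeff_monomial, ← Finset.sum_filter]
    refine Finset.sum_congr (Finset.ext fun P => ?_) fun _ _ => rfl
    simp only [Finset.mem_filter, mem_maximalOfLevel, mem_maximalOfNumLeaves]
    grind
  simp only [hcoeff]
  exact hasSum_sum fun P _ => hasSum_ite_eq P.height (ξ ^ P.dim)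

theorem coeff_mbiSpecialize {ξ : R} {S : MvPowerSeries (Fin 4) R} (hS : IsMbiSolution ξ S)
    (n : ℕ) : PowerSeries.coeff n (mbiSpecialize S) = ∑ P ∈ maximalOfNumLeaves n, ξ ^ P.dim := by
  let _ : UniformSpace R := ⊥
  have : DiscreteUniformity R := ⟨rfl⟩
  have horbit (h : ℕ) : mbiOrbit ξ h (X 0) = genSeries ξ (maximalOfLevel (h + 1)) :=
    mbiOrbit_X ξ h 0
  have hsum := hasSum_coeff_mbiOrbit hS n
  simp only [horbit] at hsum
  exact hsum.unique (hasSum_coeff_genSeries_maximalOfLevel ξ n)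

end Coefficients

theorem ncard_maximalBalancedIntervals (n : ℕ) :
    (maximalBalancedIntervals n).ncard = (maximalOfNumLeaves n).card := by
  rw [maximalBalancedIntervals_eq_image, Set.ncard_image_of_injective _ lower_upper_injective,
    ← coe_maximalOfNumLeaves, Set.ncard_coe_finset]

theorem ncard_isHypercubeInterval (n k : ℕ) :
    {I ∈ maximalBalancedIntervals n | IsHypercubeInterval I k}.ncard =
      {P ∈ maximalOfNumLeaves n | k = P.dim}.card := by
  have himage : {I ∈ maximalBalancedIntervals n | IsHypercubeInterval I k} =
      (fun P : RotationPattern => (P.lower, P.upper)) ''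
        ({P ∈ maximalOfNumLeaves n | k = P.dim} : Finset RotationPattern) := by
    ext I
    rw [Set.mem_sep_iff, maximalBalancedIntervals_eq_image, ← coe_maximalOfNumLeaves]
    simp only [Set.mem_image, Finset.mem_coe, Finset.mem_filter]
    constructor
    · rintro ⟨⟨P, hP, rfl⟩, hk⟩
      exact ⟨P, ⟨hP, eq_of_isHypercubeInterval hk P.isHypercubeInterval⟩, rfl⟩
    · rintro ⟨P, ⟨hP, rfl⟩, rfl⟩
      exact ⟨⟨P, hP, rfl⟩, P.isHypercubeInterval⟩
  rw [himage, Set.ncard_image_of_injective _ lower_upper_injective, Set.ncard_coe_finset]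

theorem mbiSpecialize_eq_maximalBalancedIntervalSeries {S : MvPowerSeries (Fin 4) ℤ}
    (hS : IsMbiSolution 1 S) : mbiSpecialize S = maximalBalancedIntervalSeries := by
  ext n
  rw [coeff_mbiSpecialize hS, maximalBalancedIntervalSeries, PowerSeries.coeff_mk,
    ncard_maximalBalancedIntervals]
  simp only [one_pow, Finset.sum_const, nsmul_one]

theorem coeff_coeff_mbiSpecialize {S : MvPowerSeries (Fin 4) (Polynomial ℤ)}
    (hS : IsMbiSolution Polynomial.X S) (n k : ℕ) :
    (PowerSeries.coeff n (mbiSpecialize S)).coeff k =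
      ({I ∈ maximalBalancedIntervals n | IsHypercubeInterval I k}.ncard : ℤ) := by
  rw [coeff_mbiSpecialize hS, ncard_isHypercubeInterval, Polynomial.finsetSum_coeff,
    ← Finset.sum_boole]
  simp only [Polynomial.coeff_X_pow]

end BalancedTamari

theorem mainTheorem6 :
    -- the functional equation without `ξ` defines `S_mbi`, and `S_mbi(x, 0, 0, 0)` enumerates
    -- the maximal balanced binary tree intervals by number of leaves
    (∃! S : MvPowerSeries (Fin 4) ℤ, IsMbiSolution (1 : ℤ) S) ∧
    (∀ S : MvPowerSeries (Fin 4) ℤ, IsMbiSolution (1 : ℤ) S →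
      mbiSpecialize S = maximalBalancedIntervalSeries) ∧
    -- each of these intervals is a hypercube of a well-defined dimension
    (∀ I : BinaryTree Unit × BinaryTree Unit, IsMaximalBalancedInterval I →
      ∃! k : ℕ, IsHypercubeInterval I k) ∧
    -- the refinement, with coefficients in `ℤ[ξ]`: the parameter `ξ` records the dimension
    (∃! S : MvPowerSeries (Fin 4) (Polynomial ℤ),
      IsMbiSolution (Polynomial.X : Polynomial ℤ) S) ∧
    (∀ S : MvPowerSeries (Fin 4) (Polynomial ℤ),
      IsMbiSolution (Polynomial.X : Polynomial ℤ) S →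
      ∀ n k : ℕ, (PowerSeries.coeff n (mbiSpecialize S)).coeff k =
        ({I ∈ maximalBalancedIntervals n | IsHypercubeInterval I k}.ncard : ℤ)) :=
  ⟨BalancedTamari.existsUnique_isMbiSolution 1,
    fun _ hS => BalancedTamari.mbiSpecialize_eq_maximalBalancedIntervalSeries hS,
    fun _ hI => BalancedTamari.existsUnique_isHypercubeInterval hI,
    BalancedTamari.existsUnique_isMbiSolution Polynomial.X,
    fun _ hS n k => BalancedTamari.coeff_coeff_mbiSpecialize hS n k⟩
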